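/- Let $n\ge 0$ and let $\mathcal U$ be a vector space of real functions on a compact interval $[a,b]$. A matrix is totally positive (TP) if all its minors are nonnegative. For functions $u_0,\dots,u_n$ on $[a,b]$ and points $t_0<\dots<t_m$ of $[a,b]$, the collocation matrix is $(u_j(t_i))_{0\le i\le m,\,0\le j\le n}$. A basis $(u_0,\dots,u_n)$ of $\mathcal U$ is an NTP basis if all its collocation matrices (for all $m$ and all $t_0<\dots<t_m$ in $[a,b]$) are TP and $\sum_{i=0}^n u_i(t)=1$ for all $t\in[a,b]$. The normalized B-basis of $\mathcal U$ is the NTP basis of $\mathcal U$ with optimal shape preserving properties, that is, an NTP basis $(b_0,\dots,b_n)$ of $\mathcal U$ such that for every NTP basis $(w_0,\dots,w_n)$ of $\mathcal U$ one has $(w_0,\dots,w_n)=(b_0,\dots,b_n)K$ with a TP matrix $K$. Let $u=(u_0,\dots,u_n)$ be an NTP basis of $\mathcal U$ and let $v=(b_0,\dots,b_n)$ be the normalized B-basis of $\mathcal U$. Let $t_0<t_1<\dots<t_n$ be nodes in $[a,b]$, and let $A=(u_j(t_i))_{0\le i,j\le n}$ and $M=(b_j(t_i))_{0\le i,j\le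 n}$ be the collocation matrices of $u$ and $v$ at these nodes. Then each of the real matrices $A$ and $M$ has a least real eigenvalue, and the minimal eigenvalue of $M$ is greater than or equal to that of $A$; likewise the minimal singular value of $M$ is greater than or equal to that of $A$. Moreover, if $A$ and $M$ are nonsingular, then $$\kappa_1(M^T)=\kappa_\infty(M)\le\kappa_\infty(A)=\kappa_1(A^T),$$ where $\kappa_p(B)=\|B\|_p\,\|B^{-1}\|_p$ and $\|\cdot\|_p$ is the matrix norm induced by the $\ell^p$ vector norm. -/

import Mathlib

/-- A (possibly rectangular) real matrix is totally positive if all its minors are nonnegative. -/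
def IsTotallyPositive {m n : ℕ} (A : Matrix (Fin m) (Fin n) ℝ) : Prop :=
  ∀ (k : ℕ) (r : Fin k → Fin m) (c : Fin k → Fin n),
    StrictMono r → StrictMono c → 0 ≤ (A.submatrix r c).det

/-- The collocation matrix `(u_j(t_i))` of the functions `u_0, …, u_n` at the nodes
`t_0, …, t_m` of `I`. -/
def collocationMatrix {I : Set ℝ} {n m : ℕ} (u : Fin (n + 1) → I → ℝ) (t : Fin (m + 1) → I) :
    Matrix (Fin (m + 1)) (Fin (n + 1)) ℝ :=
  Matrix.of fun i j => u j (t i)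

/-- A system of functions on `I` is totally positive if all its collocation matrices at
increasing nodes are totally positive. -/
def IsTPSystem {I : Set ℝ} {n : ℕ} (u : Fin (n + 1) → I → ℝ) : Prop :=
  ∀ (m : ℕ) (t : Fin (m + 1) → I), StrictMono t → IsTotallyPositive (collocationMatrix u t)

/-- A system of functions is normalized if it sums to one at every point. -/
def IsNormalizedSystem {I : Set ℝ} {n : ℕ} (u : Fin (n + 1) → I → ℝ) : Prop :=
  ∀ x : I, ∑ i, u i x = 1

/-- `u` is an NTP basis of the space of functions `U`: an (ordered) basis of `U` that is
normalized and totally positive. -/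
structure IsNTPBasis {I : Set ℝ} (U : Submodule ℝ (I → ℝ)) {n : ℕ}
    (u : Fin (n + 1) → I → ℝ) : Prop where
  linearIndependent : LinearIndependent ℝ u
  span_eq : Submodule.span ℝ (Set.range u) = U
  normalized : IsNormalizedSystem u
  totallyPositive : IsTPSystem u

/-- The comparison of bases by their shape preserving properties: `b` preserves shape at least
as well as `u` if `(u_0, …, u_n) = (b_0, …, b_n) K` with a totally positive matrix `K`.
Then the control polygon of any curve with respect to `b` arises by applying `K` to its control
polygon with respect to `u`; for normalized bases `K` is automatically stochastic, so this is
corner cutting. -/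
def PreservesShapeAtLeastAsWellAs {I : Set ℝ} {n : ℕ} (b u : Fin (n + 1) → I → ℝ) : Prop :=
  ∃ K : Matrix (Fin (n + 1)) (Fin (n + 1)) ℝ,
    IsTotallyPositive K ∧ ∀ j, u j = ∑ i, K i j • b i

/-- The normalized B-basis of `U`: the NTP basis of `U` with optimal shape preserving properties
among all NTP bases of `U`. -/
structure IsNormalizedBBasis {I : Set ℝ} (U : Submodule ℝ (I → ℝ)) {n : ℕ}
    (b : Fin (n + 1) → I → ℝ) : Prop where
  isNTPBasis : IsNTPBasis U b
  optimal : ∀ u : Fin (n + 1) → I → ℝ, IsNTPBasis U u → PreservesShapeAtLeastAsWellAs b u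

/-- `μ` is the minimal eigenvalue of the real square matrix `B`. -/
def IsMinEigenvalue {n : ℕ} (B : Matrix (Fin n) (Fin n) ℝ) (μ : ℝ) : Prop :=
  IsLeast {x : ℝ | Module.End.HasEigenvalue (Matrix.toLin' B) x} μ

/-- The minimal singular value of a square matrix of order `n + 1`: the last one of its
singular values `σ_0 ≥ σ_1 ≥ ⋯ ≥ σ_n`. -/
noncomputable def minSingularValue {n : ℕ} (B : Matrix (Fin (n + 1)) (Fin (n + 1)) ℝ) : ℝ :=
  (Matrix.toEuclideanLin B).singularValues n

/-- The matrix norm `‖B‖_p` induced by the `ℓ^p` vector norm. -/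
noncomputable def inducedNorm (p : ENNReal) [Fact (1 ≤ p)] {n : ℕ}
    (B : Matrix (Fin n) (Fin n) ℝ) : ℝ :=
  ‖(Matrix.toLpLin p p B).toContinuousLinearMap‖

/-- The condition number `κ_p(B) = ‖B‖_p ‖B⁻¹‖_p`, meaningful for nonsingular `B`. -/
noncomputable def condNumber (p : ENNReal) [Fact (1 ≤ p)] {n : ℕ}
    (B : Matrix (Fin n) (Fin n) ℝ) : ℝ :=
  inducedNorm p B * inducedNorm p B⁻¹

/-!
Since `v` is the normalized B-basis, `A = M * K` with a totally positive `K`, and comparing the two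
partitions of unity shows that the rows of `K` sum to one. So `A`, `M` and `K` are stochastic and
totally positive.

For the condition numbers, `M⁻¹ = K * A⁻¹` and `‖K‖_∞ = 1` give `‖M⁻¹‖_∞ ≤ ‖A⁻¹‖_∞`, while
`‖A‖_∞ = ‖M‖_∞ = 1`; transposition exchanges the norms for `p = 1` and `p = ∞`.

For eigenvalues and singular values in the nonsingular case, the point is that the absolute values
of the entries of `M⁻¹` are bounded by those of `A⁻¹` (`checkerboardInv_le_of_eq_mul`). The inverse
of a totally positive matrix has checkerboard signs, so there is no cancellation in
`A⁻¹ = K⁻¹ * M⁻¹`, and it suffices that the diagonal entries of `K⁻¹` are at least one. This follows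
from `K i i ≤ 1` and the inequality `det K ≤ K i i * det K(i|i)` for totally positive matrices
(`IsTotallyPositive.det_le_apply_mul_det_minor`), proved by induction on Schur complements.
The matrix of absolute values of `A⁻¹` is similar to `A⁻¹` by a diagonal matrix of signs, and both
the Perron root and the Euclidean operator norm are monotone on nonnegative matrices. These two
monotonicity statements appear as `exists_hasEigenvalue_le` and `minSingularValue_le`; the former
rests on the positivity of the resolvent of a nonnegative matrix to the right of its real
eigenvalues (`inv_smul_one_sub_nonneg`).

If `A` is singular, then its minimal singular value is zero and zero is an eigenvalue of it, whereas
`M`, being totally positive, has no negative eigenvalue.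
-/

open Matrix

/-! ### Schur complements -/

/-- The Schur complement of the upper left entry of `A`: what remains in the other rows and columns
after one step of Gaussian elimination. It is meaningful when `A 0 0 ≠ 0`. -/
noncomputable def schurComplement {m n : ℕ} (A : Matrix (Fin (m + 1)) (Fin (n + 1)) ℝ) :
    Matrix (Fin m) (Fin n) ℝ :=
  Matrix.of fun i j => A i.succ j.succ - A i.succ 0 * A 0 j.succ / A 0 0

/-- The rows of `A` below the first are cleared in column `0`, which does not change the
determinant. -/
theorem det_eq_mul_det_schurComplement {n : ℕ} (A : Matrix (Fin (n + 1)) (Fin (n + 1)) ℝ)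
    (h : A 0 0 ≠ 0) : A.det = A 0 0 * (schurComplement A).det := by
  let B : Matrix (Fin (n + 1)) (Fin (n + 1)) ℝ := Matrix.of fun i j =>
    A i j + (if i = 0 then 0 else -(A i 0 / A 0 0)) * A 0 j
  have hB : B.det = A.det :=
    det_eq_of_forall_row_eq_smul_add_const (fun i => if i = 0 then 0 else -(A i 0 / A 0 0)) 0
      (by simp) (fun i j => rfl)
  rw [← hB, det_succ_column_zero, Fin.sum_univ_succ, Finset.sum_eq_zero, add_zero]
  · have hS : B.submatrix (Fin.succAbove 0) Fin.succ = schurComplement A := by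
      ext i j
      simp [B, schurComplement]
      ring
    rw [hS]
    simp [B]
  · intro i _
    simp [B, h]

/-! ### Minors and inverses of totally positive matrices -/

/-- The inverse of `B` conjugated by the diagonal matrix with entries `1, -1, 1, …`. When `B` is
nonsingular and totally positive this is the matrix of absolute values of the entries of `B⁻¹`. -/
noncomputable def checkerboardInv {n : ℕ} (B : Matrix (Fin n) (Fin n) ℝ) :
    Matrix (Fin n) (Fin n) ℝ :=
  Matrix.of fun i j => (-1) ^ (i + j : ℕ) * B⁻¹ i j

namespace IsTotallyPositive

variable {m n : ℕ}

theorem apply_nonneg {A : Matrix (Fin m) (Fin n) ℝ} (hA : IsTotallyPositive A)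
    (i : Fin m) (j : Fin n) : 0 ≤ A i j := by
  simpa using hA 1 (fun _ => i) (fun _ => j) (Subsingleton.strictMono _)
    (Subsingleton.strictMono _)

theorem det_nonneg {A : Matrix (Fin n) (Fin n) ℝ} (hA : IsTotallyPositive A) : 0 ≤ A.det := by
  simpa using hA n id id strictMono_id strictMono_id

theorem submatrix {m' n' : ℕ} {A : Matrix (Fin m) (Fin n) ℝ} (hA : IsTotallyPositive A)
    {r : Fin m' → Fin m} {c : Fin n' → Fin n} (hr : StrictMono r) (hc : StrictMono c) :
    IsTotallyPositive (A.submatrix r c) := fun k r' c' hr' hc' =>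
  hA k (r ∘ r') (c ∘ c') (hr.comp hr') (hc.comp hc')

/-- Reversing the order of both the rows and the columns preserves total positivity. -/
theorem submatrix_rev {A : Matrix (Fin m) (Fin n) ℝ} (hA : IsTotallyPositive A) :
    IsTotallyPositive (A.submatrix Fin.rev Fin.rev) := by
  intro k r c hr hc
  have h := hA k (Fin.rev ∘ r ∘ Fin.rev) (Fin.rev ∘ c ∘ Fin.rev)
    (fun i j hij => Fin.rev_lt_rev.2 (hr (Fin.rev_lt_rev.2 hij)))
    (fun i j hij => Fin.rev_lt_rev.2 (hc (Fin.rev_lt_rev.2 hij)))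
  rw [← det_submatrix_equiv_self Fin.revPerm] at h
  convert h using 2
  ext i j
  simp

/-- Bordering a minor of the Schur complement by the row and the column of index `0` yields a minor
of `A`, equal to `A 0 0` times the original one. -/
theorem schurComplement {A : Matrix (Fin (m + 1)) (Fin (n + 1)) ℝ} (hA : IsTotallyPositive A)
    (h : 0 < A 0 0) : IsTotallyPositive (schurComplement A) := by
  intro k r c hr hc
  have strictMono_cons : ∀ {p : ℕ} {s : Fin k → Fin p}, StrictMono s →
      StrictMono (Fin.cons 0 (Fin.succ ∘ s) : Fin (k + 1) → Fin (p + 1)) := by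
    intro p s hs i j hij
    induction i using Fin.cases with
    | zero =>
      induction j using Fin.cases with
      | zero => exact absurd hij (lt_irrefl _)
      | succ j => simp [Fin.succ_pos]
    | succ i =>
      induction j using Fin.cases with
      | zero => exact absurd hij (by simp)
      | succ j => simpa using hs (Fin.succ_lt_succ_iff.1 hij)
  have hdet := hA (k + 1) _ _ (strictMono_cons hr) (strictMono_cons hc)
  rw [det_eq_mul_det_schurComplement _ (by simpa using h.ne')] at hdet
  exact nonneg_of_mul_nonneg_right hdet (by simpa using h)

/-- The `2 × 2` minors through a vanishing corner force the first row or the first column of a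
totally positive matrix to vanish. -/
theorem det_eq_zero_of_apply_zero_zero {A : Matrix (Fin (n + 1)) (Fin (n + 1)) ℝ}
    (hA : IsTotallyPositive A) (h : A 0 0 = 0) : A.det = 0 := by
  have hprod : ∀ i j, A i 0 * A 0 j = 0 := by
    intro i j
    rcases Fin.eq_zero_or_eq_succ i with rfl | ⟨i, rfl⟩
    · simp [h]
    rcases Fin.eq_zero_or_eq_succ j with rfl | ⟨j, rfl⟩
    · simp [h]
    have h2 := hA 2 ![0, i.succ] ![0, j.succ]
      (by simp [Fin.strictMono_iff_lt_succ]) (by simp [Fin.strictMono_iff_lt_succ])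
    rw [det_fin_two] at h2
    simp [h] at h2
    have h3 := mul_nonneg (hA.apply_nonneg i.succ 0) (hA.apply_nonneg 0 j.succ)
    linarith
  by_cases hcol : ∀ i, A i 0 = 0
  · exact det_eq_zero_of_column_eq_zero 0 hcol
  · push Not at hcol
    obtain ⟨i, hi⟩ := hcol
    exact det_eq_zero_of_row_eq_zero 0 fun j => (mul_eq_zero.1 (hprod i j)).resolve_left hi

/-- A Hadamard–Fischer type inequality for totally positive matrices. Elimination of the first
row and column divides both determinants by `A 0 0` and can only decrease the other diagonal
entries, which gives the bound for `i ≠ 0` by induction on the order. -/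
theorem det_le_apply_mul_det_minor {A : Matrix (Fin (n + 1)) (Fin (n + 1)) ℝ}
    (hA : IsTotallyPositive A) (i : Fin (n + 1)) :
    A.det ≤ A i i * (A.submatrix i.succAbove i.succAbove).det := by
  induction n with
  | zero =>
    obtain rfl : i = 0 := Fin.fin_one_eq_zero i
    simp
  | succ n ih =>
    have key : ∀ {A : Matrix (Fin (n + 2)) (Fin (n + 2)) ℝ}, IsTotallyPositive A →
        ∀ i : Fin (n + 1),
          A.det ≤ A i.succ i.succ * (A.submatrix i.succ.succAbove i.succ.succAbove).det := by
      intro A hA i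
      have hminor : IsTotallyPositive (A.submatrix i.succ.succAbove i.succ.succAbove) :=
        hA.submatrix (Fin.strictMono_succAbove _) (Fin.strictMono_succAbove _)
      rcases (hA.apply_nonneg 0 0).eq_or_lt with h | h
      · rw [hA.det_eq_zero_of_apply_zero_zero h.symm]
        exact mul_nonneg (hA.apply_nonneg _ _) hminor.det_nonneg
      have hS := hA.schurComplement h
      have hii : _root_.schurComplement A i i ≤ A i.succ i.succ := by
        have := div_nonneg (mul_nonneg (hA.apply_nonneg i.succ 0) (hA.apply_nonneg 0 i.succ)) h.le
        simpa [_root_.schurComplement] using this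
      have hSm : _root_.schurComplement (A.submatrix i.succ.succAbove i.succ.succAbove) =
          (_root_.schurComplement A).submatrix i.succAbove i.succAbove := by
        ext p q
        simp [_root_.schurComplement]
      rw [det_eq_mul_det_schurComplement A h.ne',
        det_eq_mul_det_schurComplement (A.submatrix _ _) (by simpa using h.ne'), hSm]
      have hSd : 0 ≤ ((_root_.schurComplement A).submatrix i.succAbove i.succAbove).det :=
        (hS.submatrix (Fin.strictMono_succAbove _) (Fin.strictMono_succAbove _)).det_nonneg
      calc A 0 0 * (_root_.schurComplement A).det
          ≤ A 0 0 * (A i.succ i.succ *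
            ((_root_.schurComplement A).submatrix i.succAbove i.succAbove).det) := by
            gcongr
            exact (ih hS i).trans (by gcongr)
        _ = _ := by simp; ring
    -- Reversing rows and columns moves the index `0` to the last one, which is a successor.
    rcases Fin.eq_zero_or_eq_succ i with rfl | ⟨i, rfl⟩
    · have h := key hA.submatrix_rev (Fin.last n)
      have hdet : (A.submatrix Fin.rev Fin.rev).det = A.det :=
        det_submatrix_equiv_self Fin.revPerm A
      have hminor : (((A.submatrix Fin.rev Fin.rev).submatrix (Fin.last n).succ.succAbove
          (Fin.last n).succ.succAbove)).det =
          (A.submatrix (Fin.succAbove 0) (Fin.succAbove 0)).det := by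
        rw [← det_submatrix_equiv_self Fin.revPerm (A.submatrix (Fin.succAbove 0) (Fin.succAbove 0))]
        congr 1
        ext p q
        simp [Fin.rev_castSucc]
      rw [hdet, hminor] at h
      simpa using h
    · exact key hA i

theorem checkerboardInv_nonneg {A : Matrix (Fin n) (Fin n) ℝ} (hA : IsTotallyPositive A)
    (i j : Fin n) : 0 ≤ checkerboardInv A i j := by
  obtain _ | n := n
  · exact i.elim0
  have hadj : 0 ≤ (-1) ^ (i + j : ℕ) * A.adjugate i j := by
    rw [adjugate_fin_succ_eq_det_submatrix, ← mul_assoc, ← pow_add,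
      Even.neg_one_pow ⟨(i + j : ℕ), by omega⟩, one_mul]
    exact hA _ _ _ (Fin.strictMono_succAbove _) (Fin.strictMono_succAbove _)
  rw [checkerboardInv, of_apply, inv_def, Ring.inverse_eq_inv', Matrix.smul_apply, smul_eq_mul,
    mul_left_comm]
  exact mul_nonneg (inv_nonneg.2 hA.det_nonneg) hadj

/-- The determinantal bound `det A ≤ A i i * det A(i|i)` read through Cramer's rule. -/
theorem one_le_inv_apply_self {A : Matrix (Fin n) (Fin n) ℝ} (hA : IsTotallyPositive A)
    (hdet : A.det ≠ 0) (i : Fin n) (hi : A i i ≤ 1) : 1 ≤ A⁻¹ i i := by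
  obtain _ | n := n
  · exact i.elim0
  have hpos : 0 < A.det := hA.det_nonneg.lt_of_ne' hdet
  have hminor : 0 ≤ (A.submatrix i.succAbove i.succAbove).det :=
    hA _ _ _ (Fin.strictMono_succAbove _) (Fin.strictMono_succAbove _)
  rw [inv_def, Ring.inverse_eq_inv', Matrix.smul_apply, smul_eq_mul, adjugate_fin_succ_eq_det_submatrix,
    Even.neg_one_pow ⟨(i : ℕ), rfl⟩, one_mul, ← div_eq_inv_mul, one_le_div hpos]
  exact (hA.det_le_apply_mul_det_minor i).trans (mul_le_of_le_one_left hminor hi)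

/-- The coefficient of `y ^ k` in `det (1 + y • A)` is the sum of the principal minors of order
`k`. -/
theorem det_one_add_smul_pos {A : Matrix (Fin n) (Fin n) ℝ} (hA : IsTotallyPositive A)
    {y : ℝ} (hy : 0 ≤ y) : 0 < (1 + y • A).det := by
  set p : Polynomial ℝ := det (1 + (Polynomial.X : Polynomial ℝ) • A.map Polynomial.C) with hp
  have heval : p.eval y = (1 + y • A).det := by
    simp [hp, eval_det, ← smul_eq_mul_diagonal]
  have hcoeff : ∀ k, 0 ≤ p.coeff k := by
    intro k
    rw [hp, coeff_det_one_add_X_smul_eq_sum_minors]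
    refine Finset.sum_nonneg fun s hs => ?_
    have h := hA s.card (s.orderEmbOfFin rfl) (s.orderEmbOfFin rfl)
      (s.orderEmbOfFin rfl).strictMono (s.orderEmbOfFin rfl).strictMono
    rw [← det_submatrix_equiv_self (s.orderIsoOfFin rfl).toEquiv]
    exact h
  have hzero : p.coeff 0 = 1 := by
    rw [hp, coeff_det_one_add_X_smul_eq_sum_minors]
    simp
  rw [← heval, Polynomial.eval_eq_sum_range' (n := p.natDegree + 1) (Nat.lt_succ_self _),
    Finset.sum_range_succ']
  have := Finset.sum_nonneg fun k (_ : k ∈ Finset.range p.natDegree) =>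
    mul_nonneg (hcoeff (k + 1)) (pow_nonneg hy (k + 1))
  simp only [hzero, pow_zero, mul_one]
  linarith

end IsTotallyPositive

/-- Since `checkerboardInv A = checkerboardInv K * checkerboardInv M` with both factors
entrywise nonnegative, and the diagonal of `checkerboardInv K` is at least one, multiplication by
`K` can only increase the absolute values of the entries of the inverse. -/
theorem checkerboardInv_le_of_eq_mul {n : ℕ} {A M K : Matrix (Fin n) (Fin n) ℝ}
    (hM : IsTotallyPositive M) (hK : IsTotallyPositive K) (hKdiag : ∀ i, K i i ≤ 1)
    (hdet : A.det ≠ 0) (hA : A = M * K) (i j : Fin n) :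
    checkerboardInv M i j ≤ checkerboardInv A i j := by
  have hKdet : K.det ≠ 0 := by
    rw [hA, det_mul] at hdet
    exact right_ne_zero_of_mul hdet
  have hsum : checkerboardInv A i j =
      ∑ k, checkerboardInv K i k * checkerboardInv M k j := by
    simp only [checkerboardInv, of_apply]
    rw [hA, Matrix.mul_inv_rev, mul_apply, Finset.mul_sum]
    refine Finset.sum_congr rfl fun k _ => ?_
    have hsign : (-1 : ℝ) ^ (i + k : ℕ) * (-1) ^ (k + j : ℕ) = (-1) ^ (i + j : ℕ) := by
      rw [← pow_add, show (i + k + (k + j) : ℕ) = i + j + 2 * k by ring, pow_add, pow_mul]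
      simp
    rw [← hsign]
    ring
  rw [hsum]
  refine le_trans ?_ (Finset.single_le_sum (fun k _ => mul_nonneg
    (hK.checkerboardInv_nonneg i k) (hM.checkerboardInv_nonneg k j)) (Finset.mem_univ i))
  refine le_mul_of_one_le_left (hM.checkerboardInv_nonneg i j) ?_
  rw [checkerboardInv, of_apply, Even.neg_one_pow ⟨(i : ℕ), rfl⟩, one_mul]
  exact hK.one_le_inv_apply_self hKdet i (hKdiag i)

/-! ### Resolvents of nonnegative matrices -/

/-- A minimum principle: at an index where `y` is smallest, a negative value would contradict
the row sum of `Q` being less than one. -/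
theorem nonneg_of_mulVec_le {n : ℕ} {Q : Matrix (Fin n) (Fin n) ℝ} (hQ : ∀ i j, 0 ≤ Q i j)
    (hsum : ∀ i, ∑ j, Q i j < 1) {y : Fin n → ℝ} (hy : ∀ i, (Q *ᵥ y) i ≤ y i) (i : Fin n) :
    0 ≤ y i := by
  have : Nonempty (Fin n) := ⟨i⟩
  obtain ⟨k, hk⟩ := Finite.exists_min y
  refine le_trans ?_ (hk i)
  by_contra! hneg
  have h1 : (∑ j, Q k j) * y k ≤ (Q *ᵥ y) k := by
    rw [Finset.sum_mul]
    exact Finset.sum_le_sum fun j _ => mul_le_mul_of_nonneg_left (hk j) (hQ k j)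
  nlinarith [hy k, hsum k]

theorem inv_nonneg_of_forall_nonneg {n : ℕ} {B : Matrix (Fin n) (Fin n) ℝ} (hB : B.det ≠ 0)
    (h : ∀ y : Fin n → ℝ, (∀ i, 0 ≤ (B *ᵥ y) i) → ∀ i, 0 ≤ y i) (i j : Fin n) :
    0 ≤ B⁻¹ i j := by
  have := h (B⁻¹ *ᵥ Pi.single j 1) (fun k => by
    rw [mulVec_mulVec, mul_nonsing_inv _ hB.isUnit, one_mulVec]
    by_cases hk : k = j <;> simp [hk]) i
  simpa using this

theorem mulVec_nonneg {m n : ℕ} {B : Matrix (Fin m) (Fin n) ℝ} (hB : ∀ i j, 0 ≤ B i j)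
    {y : Fin n → ℝ} (hy : ∀ i, 0 ≤ y i) (i : Fin m) : 0 ≤ (B *ᵥ y) i := by
  rw [mulVec, dotProduct]
  exact Finset.sum_nonneg fun j _ => mul_nonneg (hB i j) (hy j)

theorem sub_mulVec_apply {n : ℕ} (P : Matrix (Fin n) (Fin n) ℝ) (s : ℝ) (y : Fin n → ℝ)
    (i : Fin n) : ((s • 1 - P) *ᵥ y) i = s * y i - (P *ᵥ y) i := by
  simp [sub_mulVec, smul_mulVec]

/-- For an entrywise nonnegative `P`, the resolvent `(s • 1 - P)⁻¹` is entrywise nonnegative at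
every `s₀ > 0` such that it exists on all of `[s₀, ∞)`. The resolvent is nonnegative for large `s`, and
by continuity this propagates down to `s₀`. -/
theorem inv_smul_one_sub_nonneg {n : ℕ} {P : Matrix (Fin n) (Fin n) ℝ}
    (hP : ∀ i j, 0 ≤ P i j) {s₀ : ℝ} (hs₀ : 0 < s₀)
    (hdet : ∀ s, s₀ ≤ s → (s • (1 : Matrix (Fin n) (Fin n) ℝ) - P).det ≠ 0) (i j : Fin n) :
    0 ≤ (s₀ • (1 : Matrix (Fin n) (Fin n) ℝ) - P)⁻¹ i j := by
  have row_le : ∀ {B : Matrix (Fin n) (Fin n) ℝ}, (∀ i j, 0 ≤ B i j) → ∀ i,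
      ∑ j, B i j ≤ ∑ i, ∑ j, B i j := fun hB i =>
    Finset.single_le_sum (f := fun i => ∑ j, _) (fun k _ => Finset.sum_nonneg fun j _ => hB k j)
      (Finset.mem_univ i)
  have sum_nonneg : ∀ {B : Matrix (Fin n) (Fin n) ℝ}, (∀ i j, 0 ≤ B i j) →
      0 ≤ ∑ i, ∑ j, B i j := fun hB =>
    Finset.sum_nonneg fun i _ => Finset.sum_nonneg fun j _ => hB i j
  -- At `S` the row sums of `S⁻¹ • P` are less than one.
  set S : ℝ := s₀ + ∑ i, ∑ j, P i j with hS
  have hs₀S : s₀ ≤ S := le_add_of_nonneg_right (sum_nonneg hP)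
  let G : Set ℝ := {s | ∀ i j, 0 ≤ (s • (1 : Matrix (Fin n) (Fin n) ℝ) - P)⁻¹ i j}
  suffices s₀ ∈ G from this i j
  refine IsClosed.mem_of_ge_of_forall_exists_lt (b := S) ?_ ?_ hs₀S ?_
  · have hcont : ContinuousOn (fun s : ℝ => (s • (1 : Matrix (Fin n) (Fin n) ℝ) - P)⁻¹)
        (Set.Icc s₀ S) := by
      simp_rw [inv_def, Ring.inverse_eq_inv']
      have h : Continuous fun s : ℝ => s • (1 : Matrix (Fin n) (Fin n) ℝ) - P := by fun_prop
      exact (h.matrix_det.continuousOn.inv₀ fun s hs => hdet s hs.1).smul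
        h.matrix_adjugate.continuousOn
    have hclosed : IsClosed {B : Matrix (Fin n) (Fin n) ℝ | ∀ i j, 0 ≤ B i j} := by
      simp only [Set.ofPred_forall]
      exact isClosed_iInter fun i => isClosed_iInter fun j =>
        isClosed_le continuous_const (continuous_id.matrix_elem i j)
    rw [Set.inter_comm]
    exact hcont.preimage_isClosed_of_isClosed isClosed_Icc hclosed
  · have hSpos : 0 < S := hs₀.trans_le hs₀S
    refine inv_nonneg_of_forall_nonneg (hdet S hs₀S) fun y hy => ?_
    refine nonneg_of_mulVec_le (Q := S⁻¹ • P) (fun i j => ?_) (fun i => ?_) fun i => ?_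
    · exact mul_nonneg (inv_nonneg.2 hSpos.le) (hP i j)
    · simp only [Matrix.smul_apply, smul_eq_mul, ← Finset.mul_sum]
      rw [inv_mul_lt_one₀ hSpos]
      linarith [row_le hP i]
    · have := hy i
      rw [sub_mulVec_apply] at this
      rw [smul_mulVec, Pi.smul_apply, smul_eq_mul, inv_mul_le_iff₀ hSpos]
      linarith
  · rintro s ⟨hsG, hs₀s, -⟩
    -- If `R = (s • 1 - P)⁻¹ ≥ 0`, then `R * ((s - ε) • 1 - P) = 1 - ε • R`, to which the minimum
    -- principle applies once `ε` is small.
    set R := (s • (1 : Matrix (Fin n) (Fin n) ℝ) - P)⁻¹ with hR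
    have hRnn : ∀ i j, 0 ≤ R i j := hsG
    obtain ⟨ε, hε, hεs, hεR⟩ : ∃ ε : ℝ, 0 < ε ∧ ε ≤ s - s₀ ∧ ε * ∑ i, ∑ j, R i j < 1 := by
      have hT := sum_nonneg hRnn
      refine ⟨min (s - s₀) (1 / (1 + ∑ i, ∑ j, R i j)), ?_, min_le_left _ _, ?_⟩
      · exact lt_min (sub_pos.2 hs₀s) (by positivity)
      · refine (mul_le_mul_of_nonneg_right (min_le_right _ _) hT).trans_lt ?_
        rw [one_div, inv_mul_lt_one₀ (by positivity)]
        linarith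
    refine ⟨s - ε, ?_, by linarith, by linarith⟩
    refine inv_nonneg_of_forall_nonneg (hdet _ (by linarith)) fun y hy => ?_
    refine nonneg_of_mulVec_le (Q := ε • R) (fun i j => mul_nonneg hε.le (hRnn i j))
      (fun i => ?_) fun i => ?_
    · simp only [Matrix.smul_apply, smul_eq_mul, ← Finset.mul_sum]
      exact (mul_le_mul_of_nonneg_left (row_le hRnn i) hε.le).trans_lt hεR
    · have h := mulVec_nonneg hRnn hy i
      have hsplit : (s - ε) • (1 : Matrix (Fin n) (Fin n) ℝ) - P =
          (s • (1 : Matrix (Fin n) (Fin n) ℝ) - P) - ε • (1 : Matrix (Fin n) (Fin n) ℝ) := by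
        rw [sub_smul]; abel
      rw [hsplit, mulVec_mulVec, mul_sub, hR,
        nonsing_inv_mul _ (hdet s hs₀s.le).isUnit, ← hR] at h
      simpa [sub_mulVec] using h

theorem nonneg_of_mulVec_le_smul {n : ℕ} {P : Matrix (Fin n) (Fin n) ℝ}
    (hP : ∀ i j, 0 ≤ P i j) {s₀ : ℝ} (hs₀ : 0 < s₀)
    (hdet : ∀ s, s₀ ≤ s → (s • (1 : Matrix (Fin n) (Fin n) ℝ) - P).det ≠ 0) {y : Fin n → ℝ}
    (hy : ∀ i, (P *ᵥ y) i ≤ s₀ * y i) (i : Fin n) : 0 ≤ y i := by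
  have h := mulVec_nonneg (inv_smul_one_sub_nonneg hP hs₀ hdet)
    (y := (s₀ • 1 - P) *ᵥ y) (fun i => by rw [sub_mulVec_apply]; linarith [hy i]) i
  rwa [mulVec_mulVec, nonsing_inv_mul _ (hdet s₀ le_rfl).isUnit, one_mulVec] at h

/-! ### Comparison of eigenvalues -/

/-- Multiplication of a vector by the diagonal matrix with entries `1, -1, 1, …`. -/
def alternateSigns {n : ℕ} (x : Fin n → ℝ) : Fin n → ℝ := fun i => (-1) ^ (i : ℕ) * x i

theorem abs_alternateSigns_apply {n : ℕ} (x : Fin n → ℝ) (i : Fin n) :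
    |alternateSigns x i| = |x i| := by
  simp [alternateSigns, abs_mul]

theorem alternateSigns_alternateSigns {n : ℕ} (x : Fin n → ℝ) :
    alternateSigns (alternateSigns x) = x := by
  ext i
  simp [alternateSigns, ← mul_assoc, ← mul_pow]

theorem alternateSigns_smul {n : ℕ} (c : ℝ) (x : Fin n → ℝ) :
    alternateSigns (c • x) = c • alternateSigns x := by
  ext i
  simp only [alternateSigns, Pi.smul_apply, smul_eq_mul]
  ring

theorem alternateSigns_ne_zero {n : ℕ} {x : Fin n → ℝ} (hx : x ≠ 0) : alternateSigns x ≠ 0 := by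
  contrapose! hx
  rw [← alternateSigns_alternateSigns x, hx]
  ext i
  simp [alternateSigns]

theorem checkerboardInv_mulVec {n : ℕ} (B : Matrix (Fin n) (Fin n) ℝ) (x : Fin n → ℝ) :
    checkerboardInv B *ᵥ x = alternateSigns (B⁻¹ *ᵥ alternateSigns x) := by
  ext i
  simp only [checkerboardInv, alternateSigns, mulVec, dotProduct, of_apply, Finset.mul_sum]
  exact Finset.sum_congr rfl fun j _ => by rw [pow_add]; ring

theorem abs_mulVec_le_of_le {n : ℕ} {N P : Matrix (Fin n) (Fin n) ℝ} (hN : ∀ i j, 0 ≤ N i j)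
    (hNP : ∀ i j, N i j ≤ P i j) (x : Fin n → ℝ) (i : Fin n) :
    |(N *ᵥ x) i| ≤ (P *ᵥ |x|) i := by
  rw [mulVec, dotProduct, mulVec, dotProduct]
  refine (Finset.abs_sum_le_sum_abs _ _).trans (Finset.sum_le_sum fun j _ => ?_)
  rw [abs_mul, abs_of_nonneg (hN i j)]
  exact mul_le_mul_of_nonneg_right (hNP i j) (abs_nonneg _)

theorem hasEigenvalue_toLin'_iff {n : ℕ} {B : Matrix (Fin n) (Fin n) ℝ} {μ : ℝ} :
    Module.End.HasEigenvalue (toLin' B) μ ↔ ∃ x ≠ 0, B *ᵥ x = μ • x := by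
  constructor
  · intro h
    obtain ⟨x, hx⟩ := h.exists_hasEigenvector
    exact ⟨x, hx.2, by simpa using hx.apply_eq_smul⟩
  · rintro ⟨x, hx0, hx⟩
    exact Module.End.hasEigenvalue_of_hasEigenvector
      (Module.End.hasEigenvector_iff.2 ⟨Module.End.mem_eigenspace_iff.2 (by simpa using hx), hx0⟩)

/-- If no eigenvalue of `A` were at most `μ`, then `checkerboardInv A`, which is similar to `A⁻¹`,
would have no real eigenvalue in `[μ⁻¹, ∞)`, so its resolvent at `μ⁻¹` would be nonnegative. For
`M *ᵥ w = μ • w` the vector `|w|` satisfies `μ⁻¹ • |w| ≤ checkerboardInv A *ᵥ |w|`, and then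
`|w| ≤ 0`. -/
theorem exists_hasEigenvalue_le {n : ℕ} {A M : Matrix (Fin n) (Fin n) ℝ} (hA : A.det ≠ 0)
    (hM : M.det ≠ 0) (hnonneg : ∀ i j, 0 ≤ checkerboardInv M i j)
    (hle : ∀ i j, checkerboardInv M i j ≤ checkerboardInv A i j) {μ : ℝ} (hμ : 0 < μ)
    (h : Module.End.HasEigenvalue (toLin' M) μ) :
    ∃ l ≤ μ, Module.End.HasEigenvalue (toLin' A) l := by
  by_contra! hno
  have hdet : ∀ s, μ⁻¹ ≤ s →
      (s • (1 : Matrix (Fin n) (Fin n) ℝ) - checkerboardInv A).det ≠ 0 := by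
    intro s hs hzero
    have hspos : 0 < s := (inv_pos.2 hμ).trans_le hs
    obtain ⟨x, hx0, hx⟩ := exists_mulVec_eq_zero_iff.2 hzero
    refine hno s⁻¹ (inv_le_of_inv_le₀ hμ hs)
      (hasEigenvalue_toLin'_iff.2 ⟨alternateSigns x, alternateSigns_ne_zero hx0, ?_⟩)
    rw [sub_mulVec, smul_mulVec, one_mulVec, sub_eq_zero, checkerboardInv_mulVec] at hx
    have hx' : s • alternateSigns x = A⁻¹ *ᵥ alternateSigns x := by
      rw [← alternateSigns_smul, hx, alternateSigns_alternateSigns]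
    have hx2 : s • (A *ᵥ alternateSigns x) = alternateSigns x := by
      rw [← mulVec_smul, hx', mulVec_mulVec, mul_nonsing_inv _ hA.isUnit, one_mulVec]
    rw [eq_inv_smul_iff₀ hspos.ne', hx2]
  obtain ⟨w, hw0, hw⟩ := hasEigenvalue_toLin'_iff.1 h
  have hinv : M⁻¹ *ᵥ w = μ⁻¹ • w := by
    rw [eq_inv_smul_iff₀ hμ.ne', ← mulVec_smul, ← hw, mulVec_mulVec,
      nonsing_inv_mul _ hM.isUnit, one_mulVec]
  have habs := nonneg_of_mulVec_le_smul (fun i j => (hnonneg i j).trans (hle i j))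
    (inv_pos.2 hμ) hdet (y := -|w|) (fun i => by
      have := abs_mulVec_le_of_le hnonneg hle (alternateSigns w) i
      have hal : |alternateSigns w| = |w| := funext fun i => abs_alternateSigns_apply w i
      rw [checkerboardInv_mulVec, alternateSigns_alternateSigns, hinv, alternateSigns_smul,
        hal, Pi.smul_apply, smul_eq_mul, abs_mul, abs_alternateSigns_apply,
        abs_of_pos (inv_pos.2 hμ)] at this
      simp only [mulVec_neg, Pi.neg_apply, Pi.abs_apply]
      linarith)
  refine hw0 (funext fun i => ?_)
  have := habs i
  simp only [Pi.neg_apply, Pi.abs_apply] at this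
  simpa using le_antisymm (by linarith) (abs_nonneg (w i))

/-! ### Comparison of minimal singular values -/

theorem singularValues_mul_norm_le {E F : Type*} [NormedAddCommGroup E] [InnerProductSpace ℝ E]
    [FiniteDimensional ℝ E] [NormedAddCommGroup F] [InnerProductSpace ℝ F]
    [FiniteDimensional ℝ F] (T : E →ₗ[ℝ] F) {n : ℕ} (hn : Module.finrank ℝ E = n + 1) (x : E) :
    T.singularValues n * ‖x‖ ≤ ‖T x‖ := by
  have hsym := T.isSymmetric_adjoint_comp_self
  set b := hsym.eigenvectorBasis hn with hb
  have hinner : ‖T x‖ ^ 2 = ∑ i, hsym.eigenvalues hn i * ‖inner ℝ x (b i)‖ ^ 2 := by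
    rw [← real_inner_self_eq_norm_sq, ← LinearMap.adjoint_inner_right,
      ← b.sum_inner_mul_inner]
    refine Finset.sum_congr rfl fun i _ => ?_
    have h1 : inner ℝ (b i) (T.adjoint (T x)) = hsym.eigenvalues hn i * inner ℝ (b i) x := by
      rw [← LinearMap.comp_apply, ← hsym, hsym.apply_eigenvectorBasis hn i, ← hb]
      simp [inner_smul_left]
    rw [h1, real_inner_comm x (b i), Real.norm_eq_abs, sq_abs]
    ring
  refine le_of_sq_le_sq ?_ (norm_nonneg _)
  rw [hinner, mul_pow, ← b.sum_sq_norm_inner_left x, Finset.mul_sum]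
  refine Finset.sum_le_sum fun i _ => mul_le_mul_of_nonneg_right ?_ (sq_nonneg _)
  rw [T.sq_singularValues_of_lt hn n.lt_succ_self]
  exact hsym.eigenvalues_antitone hn (Fin.le_last i)

theorem exists_norm_eq_singularValues_mul {E F : Type*} [NormedAddCommGroup E]
    [InnerProductSpace ℝ E] [FiniteDimensional ℝ E] [NormedAddCommGroup F]
    [InnerProductSpace ℝ F] [FiniteDimensional ℝ F] (T : E →ₗ[ℝ] F) {n : ℕ}
    (hn : n < Module.finrank ℝ E) : ∃ x ≠ 0, ‖T x‖ = T.singularValues n * ‖x‖ := by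
  obtain ⟨x, hx⟩ :=
    (T.hasEigenvalue_adjoint_comp_self_sq_singularValues hn).exists_hasEigenvector
  refine ⟨x, hx.2, ?_⟩
  rw [← sq_eq_sq₀ (norm_nonneg _) (mul_nonneg (T.singularValues_nonneg n) (norm_nonneg _)),
    ← real_inner_self_eq_norm_sq, ← LinearMap.adjoint_inner_right, ← LinearMap.comp_apply,
    hx.apply_eq_smul, inner_smul_right, real_inner_self_eq_norm_sq]
  simp [mul_pow]

/-- Put `y = M *ᵥ x` and let `z` be the solution of `A *ᵥ z = alternateSigns |y|`. The entries of
`x = M⁻¹ *ᵥ y` are bounded in absolute value by those of `z`, while `A *ᵥ z` and `M *ᵥ x` have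
equal norms. -/
theorem minSingularValue_le {n : ℕ} {A M : Matrix (Fin (n + 1)) (Fin (n + 1)) ℝ}
    (hA : A.det ≠ 0) (hM : M.det ≠ 0) (hnonneg : ∀ i j, 0 ≤ checkerboardInv M i j)
    (hle : ∀ i j, checkerboardInv M i j ≤ checkerboardInv A i j) :
    minSingularValue A ≤ minSingularValue M := by
  obtain ⟨x, hx0, hx⟩ := exists_norm_eq_singularValues_mul (toEuclideanLin M) (n := n) (by simp)
  set y : Fin (n + 1) → ℝ := M *ᵥ x.ofLp with hy
  set z : Fin (n + 1) → ℝ := A⁻¹ *ᵥ alternateSigns |y| with hz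
  have hxy : M⁻¹ *ᵥ y = x.ofLp := by
    rw [hy, mulVec_mulVec, nonsing_inv_mul _ hM.isUnit, one_mulVec]
  have hAz : A *ᵥ z = alternateSigns |y| := by
    rw [hz, mulVec_mulVec, mul_nonsing_inv _ hA.isUnit, one_mulVec]
  have hxz : ∀ i, |x i| ≤ |z i| := by
    intro i
    have h := abs_mulVec_le_of_le hnonneg hle (alternateSigns y) i
    have hal : |alternateSigns y| = |y| := funext fun i => abs_alternateSigns_apply y i
    rw [checkerboardInv_mulVec, alternateSigns_alternateSigns, hxy, abs_alternateSigns_apply,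
      hal, checkerboardInv_mulVec, ← hz] at h
    exact h.trans ((le_abs_self _).trans (abs_alternateSigns_apply z i).le)
  have hnorm : ‖x‖ ≤ ‖WithLp.toLp 2 z‖ := by
    rw [EuclideanSpace.norm_eq, EuclideanSpace.norm_eq]
    exact Real.sqrt_le_sqrt (Finset.sum_le_sum fun i _ =>
      pow_le_pow_left₀ (norm_nonneg _) (hxz i) 2)
  have himage : ‖toEuclideanLin A (WithLp.toLp 2 z)‖ = ‖toEuclideanLin M x‖ := by
    rw [toLpLin_apply, toLpLin_apply, ← hy, EuclideanSpace.norm_eq, EuclideanSpace.norm_eq]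
    simp [hAz, abs_alternateSigns_apply]
  have h := singularValues_mul_norm_le (toEuclideanLin A) (n := n) (by simp) (WithLp.toLp 2 z)
  rw [himage, hx] at h
  exact le_of_mul_le_mul_right
    ((mul_le_mul_of_nonneg_left hnorm (LinearMap.singularValues_nonneg _ n)).trans h)
    (norm_pos_iff.2 hx0)

theorem minSingularValue_eq_zero {n : ℕ} {A : Matrix (Fin (n + 1)) (Fin (n + 1)) ℝ}
    (hA : A.det = 0) : minSingularValue A = 0 := by
  obtain ⟨x, hx0, hx⟩ := exists_mulVec_eq_zero_iff.2 hA
  have h := singularValues_mul_norm_le (toEuclideanLin A) (n := n) (by simp) (WithLp.toLp 2 x)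
  rw [toLpLin_apply, hx, WithLp.toLp_zero, norm_zero] at h
  refine le_antisymm (nonpos_of_mul_nonpos_left h (norm_pos_iff.2 ?_))
    (LinearMap.singularValues_nonneg _ n)
  simpa using hx0

/-! ### Induced norms and condition numbers -/

theorem inducedNorm_le_iff {p : ENNReal} [Fact (1 ≤ p)] {n : ℕ} (B : Matrix (Fin n) (Fin n) ℝ)
    {c : ℝ} (hc : 0 ≤ c) : inducedNorm p B ≤ c ↔
      ∀ x : Fin n → ℝ, ‖WithLp.toLp p (B *ᵥ x)‖ ≤ c * ‖WithLp.toLp p x‖ := by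
  rw [inducedNorm, ContinuousLinearMap.opNorm_le_iff hc]
  exact ⟨fun h x => h (WithLp.toLp p x), fun h x => h x.ofLp⟩

theorem inducedNorm_top_le_iff {n : ℕ} (B : Matrix (Fin n) (Fin n) ℝ) {c : ℝ} (hc : 0 ≤ c) :
    inducedNorm ⊤ B ≤ c ↔ ∀ i, ∑ j, |B i j| ≤ c := by
  simp only [inducedNorm_le_iff B hc, PiLp.norm_toLp]
  constructor
  · intro h i
    -- The vector of signs of row `i` attains the absolute row sum.
    have hx : ‖fun j => (SignType.sign (B i j) : ℝ)‖ ≤ 1 := by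
      refine (pi_norm_le_iff_of_nonneg zero_le_one).2 fun j => ?_
      rcases lt_trichotomy (B i j) 0 with h | h | h <;> simp [h]
    refine le_trans ?_ ((norm_le_pi_norm _ i).trans ((h _).trans (mul_le_of_le_one_right hc hx)))
    simp [mulVec, dotProduct, le_abs_self]
  · intro h x
    refine (pi_norm_le_iff_of_nonneg (by positivity)).2 fun i => ?_
    calc ‖(B *ᵥ x) i‖ ≤ ∑ j, |B i j * x j| := by
          rw [mulVec, dotProduct, Real.norm_eq_abs]
          exact Finset.abs_sum_le_sum_abs _ _
      _ ≤ ∑ j, |B i j| * ‖x‖ := Finset.sum_le_sum fun j _ => by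
          rw [abs_mul]
          exact mul_le_mul_of_nonneg_left (norm_le_pi_norm x j) (abs_nonneg _)
      _ ≤ c * ‖x‖ := by
          rw [← Finset.sum_mul]
          exact mul_le_mul_of_nonneg_right (h i) (norm_nonneg _)

theorem inducedNorm_one_le_iff {n : ℕ} (B : Matrix (Fin n) (Fin n) ℝ) {c : ℝ} (hc : 0 ≤ c) :
    inducedNorm 1 B ≤ c ↔ ∀ j, ∑ i, |B i j| ≤ c := by
  simp only [inducedNorm_le_iff B hc, PiLp.norm_eq_of_L1, Real.norm_eq_abs]
  constructor
  · intro h j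
    simpa [Pi.single_apply, apply_ite abs] using h (Pi.single j 1)
  · intro h x
    calc ∑ i, |(B *ᵥ x) i| ≤ ∑ i, ∑ j, |B i j| * |x j| := Finset.sum_le_sum fun i _ => by
          simpa only [mulVec, dotProduct, abs_mul] using
            Finset.abs_sum_le_sum_abs (fun j => B i j * x j) Finset.univ
      _ = ∑ j, (∑ i, |B i j|) * |x j| := by
          rw [Finset.sum_comm]
          simp_rw [Finset.sum_mul]
      _ ≤ c * ∑ j, |x j| := by
          rw [Finset.mul_sum]
          exact Finset.sum_le_sum fun j _ => mul_le_mul_of_nonneg_right (h j) (abs_nonneg _)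

theorem inducedNorm_nonneg {p : ENNReal} [Fact (1 ≤ p)] {n : ℕ} (B : Matrix (Fin n) (Fin n) ℝ) :
    0 ≤ inducedNorm p B :=
  norm_nonneg _

theorem inducedNorm_one_transpose {n : ℕ} (B : Matrix (Fin n) (Fin n) ℝ) :
    inducedNorm 1 Bᵀ = inducedNorm ⊤ B :=
  le_antisymm
    ((inducedNorm_one_le_iff _ (inducedNorm_nonneg B)).2
      ((inducedNorm_top_le_iff B (inducedNorm_nonneg B)).1 le_rfl))
    ((inducedNorm_top_le_iff _ (inducedNorm_nonneg Bᵀ)).2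
      ((inducedNorm_one_le_iff Bᵀ (inducedNorm_nonneg Bᵀ)).1 le_rfl))

theorem condNumber_one_transpose {n : ℕ} (B : Matrix (Fin n) (Fin n) ℝ) :
    condNumber 1 Bᵀ = condNumber ⊤ B := by
  rw [condNumber, condNumber, ← transpose_nonsing_inv, inducedNorm_one_transpose,
    inducedNorm_one_transpose]

theorem inducedNorm_mul_le {p : ENNReal} [Fact (1 ≤ p)] {n : ℕ}
    (B C : Matrix (Fin n) (Fin n) ℝ) :
    inducedNorm p (B * C) ≤ inducedNorm p B * inducedNorm p C := by
  refine (inducedNorm_le_iff _ (mul_nonneg (inducedNorm_nonneg B) (inducedNorm_nonneg C))).2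
    fun x => ?_
  rw [← mulVec_mulVec, mul_assoc]
  exact ((inducedNorm_le_iff B (inducedNorm_nonneg B)).1 le_rfl _).trans
    (mul_le_mul_of_nonneg_left ((inducedNorm_le_iff C (inducedNorm_nonneg C)).1 le_rfl _)
      (inducedNorm_nonneg B))

theorem inducedNorm_top_eq_one {n : ℕ} {B : Matrix (Fin (n + 1)) (Fin (n + 1)) ℝ}
    (hB : ∀ i j, 0 ≤ B i j) (hsum : ∀ i, ∑ j, B i j = 1) : inducedNorm ⊤ B = 1 := by
  have habs : ∀ i, ∑ j, |B i j| = 1 := fun i => by simp [abs_of_nonneg (hB i _), hsum]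
  refine le_antisymm ((inducedNorm_top_le_iff B zero_le_one).2 fun i => (habs i).le) ?_
  rw [← habs 0]
  exact (inducedNorm_top_le_iff B (inducedNorm_nonneg B)).1 le_rfl 0

/-! ### Stochastic collocation matrices -/

theorem exists_isMinEigenvalue {n : ℕ} {B : Matrix (Fin n) (Fin n) ℝ} {x : ℝ}
    (hx : Module.End.HasEigenvalue (toLin' B) x) : ∃ μ, IsMinEigenvalue B μ := by
  obtain ⟨μ, hμ, hmin⟩ :=
    Set.exists_min_image _ id (Module.End.finite_hasEigenvalue (toLin' B)) ⟨x, hx⟩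
  exact ⟨μ, hμ, fun y hy => hmin y hy⟩

theorem hasEigenvalue_one_of_sum_eq_one {n : ℕ} {B : Matrix (Fin (n + 1)) (Fin (n + 1)) ℝ}
    (hsum : ∀ i, ∑ j, B i j = 1) : Module.End.HasEigenvalue (toLin' B) 1 :=
  hasEigenvalue_toLin'_iff.2 ⟨1, one_ne_zero, by
    ext i
    simpa [mulVec, dotProduct] using hsum i⟩

theorem hasEigenvalue_zero_iff {n : ℕ} {B : Matrix (Fin n) (Fin n) ℝ} :
    Module.End.HasEigenvalue (toLin' B) 0 ↔ B.det = 0 := by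
  rw [hasEigenvalue_toLin'_iff, ← exists_mulVec_eq_zero_iff]
  simp

theorem IsTotallyPositive.eigenvalue_nonneg {n : ℕ} {B : Matrix (Fin n) (Fin n) ℝ}
    (hB : IsTotallyPositive B) {μ : ℝ} (h : Module.End.HasEigenvalue (toLin' B) μ) : 0 ≤ μ := by
  by_contra! hneg
  obtain ⟨x, hx0, hx⟩ := hasEigenvalue_toLin'_iff.1 h
  refine (hB.det_one_add_smul_pos (y := -μ⁻¹) (by simpa using hneg.le)).ne'
    (exists_mulVec_eq_zero_iff.1 ⟨x, hx0, ?_⟩)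
  rw [add_mulVec, one_mulVec, smul_mulVec, hx, smul_smul, neg_mul, inv_mul_cancel₀ hneg.ne]
  simp

/-- A matrix expressing a normalized system in a normalized basis has row sums one. -/
theorem IsNTPBasis.sum_eq_one_of_eq_sum_smul {I : Set ℝ} {U : Submodule ℝ (I → ℝ)} {n : ℕ}
    {u b : Fin (n + 1) → I → ℝ} (hu : IsNormalizedSystem u) (hb : IsNTPBasis U b)
    {K : Matrix (Fin (n + 1)) (Fin (n + 1)) ℝ} (hK : ∀ j, u j = ∑ i, K i j • b i)
    (i : Fin (n + 1)) : ∑ j, K i j = 1 := by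
  have hzero : ∑ i, (∑ j, K i j - 1) • b i = 0 := by
    have h1 : ∑ j, u j = ∑ i, b i := by
      ext x
      simp [hu x, hb.normalized x]
    simp_rw [sub_smul, one_smul, Finset.sum_sub_distrib, Finset.sum_smul]
    rw [Finset.sum_comm, ← h1, sub_eq_zero]
    exact Finset.sum_congr rfl fun j _ => (hK j).symm
  exact sub_eq_zero.1 (Fintype.linearIndependent_iff.1 hb.linearIndependent _ hzero i)

theorem corollary3p3 {a b : ℝ} {n : ℕ} (U : Submodule ℝ (Set.Icc a b → ℝ))
    (u v : Fin (n + 1) → Set.Icc a b → ℝ)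
    (hu : IsNTPBasis U u) (hv : IsNormalizedBBasis U v)
    (t : Fin (n + 1) → Set.Icc a b) (ht : StrictMono t)
    (A M : Matrix (Fin (n + 1)) (Fin (n + 1)) ℝ)
    (hA : A = collocationMatrix u t) (hM : M = collocationMatrix v t) :
    (∃ eigM eigA : ℝ, IsMinEigenvalue M eigM ∧ IsMinEigenvalue A eigA ∧ eigA ≤ eigM) ∧
    minSingularValue A ≤ minSingularValue M ∧
    (IsUnit A.det → IsUnit M.det →
      condNumber 1 M.transpose = condNumber ⊤ M ∧
      condNumber ⊤ M ≤ condNumber ⊤ A ∧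
      condNumber ⊤ A = condNumber 1 A.transpose) := by
  obtain ⟨K, hK, huK⟩ := hv.optimal u hu
  have hAMK : A = M * K := by
    ext i j
    simp [hA, hM, collocationMatrix, huK j, mul_apply, mul_comm]
  have hKsum : ∀ i, ∑ j, K i j = 1 := hv.isNTPBasis.sum_eq_one_of_eq_sum_smul hu.normalized huK
  have hKdiag : ∀ i, K i i ≤ 1 := fun i => by
    rw [← hKsum i]
    exact Finset.single_le_sum (f := K i) (fun j _ => hK.apply_nonneg i j) (Finset.mem_univ i)
  have hAtp : IsTotallyPositive A := by
    rw [hA]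
    exact hu.totallyPositive n t ht
  have hMtp : IsTotallyPositive M := by
    rw [hM]
    exact hv.isNTPBasis.totallyPositive n t ht
  have hAsum : ∀ i, ∑ j, A i j = 1 := fun i => by
    rw [hA]
    exact hu.normalized (t i)
  have hMsum : ∀ i, ∑ j, M i j = 1 := fun i => by
    rw [hM]
    exact hv.isNTPBasis.normalized (t i)
  have hMdet : A.det ≠ 0 → M.det ≠ 0 := fun h => by
    rw [hAMK, det_mul] at h
    exact left_ne_zero_of_mul h
  have hle : A.det ≠ 0 → ∀ i j, checkerboardInv M i j ≤ checkerboardInv A i j := fun h =>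
    checkerboardInv_le_of_eq_mul hMtp hK hKdiag h hAMK
  refine ⟨?_, ?_, fun hAu hMu => ⟨condNumber_one_transpose M, ?_,
    (condNumber_one_transpose A).symm⟩⟩
  -- Row sums one make `1` an eigenvalue of both matrices, so the least eigenvalues exist.
  · obtain ⟨eigM, hM₁⟩ := exists_isMinEigenvalue (hasEigenvalue_one_of_sum_eq_one hMsum)
    obtain ⟨eigA, hA₁⟩ := exists_isMinEigenvalue (hasEigenvalue_one_of_sum_eq_one hAsum)
    refine ⟨eigM, eigA, hM₁, hA₁, ?_⟩
    have hnn : 0 ≤ eigM := hMtp.eigenvalue_nonneg hM₁.1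
    by_cases hdet : A.det = 0
    · exact (hA₁.2 (hasEigenvalue_zero_iff.2 hdet)).trans hnn
    have hpos : 0 < eigM := hnn.lt_of_ne' fun h =>
      hMdet hdet (hasEigenvalue_zero_iff.1 (h ▸ hM₁.1))
    obtain ⟨l, hl, hl'⟩ := exists_hasEigenvalue_le hdet (hMdet hdet)
      hMtp.checkerboardInv_nonneg (hle hdet) hpos hM₁.1
    exact (hA₁.2 hl').trans hl
  · by_cases hdet : A.det = 0
    · rw [minSingularValue_eq_zero hdet]
      exact LinearMap.singularValues_nonneg _ n
    · exact minSingularValue_le hdet (hMdet hdet) hMtp.checkerboardInv_nonneg (hle hdet)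
  · have hinv : M⁻¹ = K * A⁻¹ := by
      rw [eq_comm, ← nonsing_inv_mul_cancel_left (A := M) (K * A⁻¹) hMu, ← Matrix.mul_assoc M,
        ← hAMK, mul_nonsing_inv _ hAu, Matrix.mul_one]
    rw [condNumber, condNumber, inducedNorm_top_eq_one hMtp.apply_nonneg hMsum,
      inducedNorm_top_eq_one hAtp.apply_nonneg hAsum, one_mul, one_mul, hinv]
    refine (inducedNorm_mul_le K A⁻¹).trans_eq ?_
    rw [inducedNorm_top_eq_one hK.apply_nonneg hKsum, one_mul]
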